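/- A \emph{Gowers space} is a quintuple $\mathcal{G} = (P, X, \leqslant, \leqslant^*, \vartriangleleft)$, where $P$ is a nonempty set (of \emph{subspaces}), $X$ is a nonempty, at most countable set (of \emph{points}), $\leqslant$ and $\leqslant^*$ are quasiorders (reflexive and transitive relations) on $P$, and $\vartriangleleft$ is a relation between nonempty finite sequences of elements of $X$ and elements of $P$, such that: \begin{enumerate} \item for all $p, q \in P$, if $p \leqslant q$ then $p \leqslant^* q$; \item for all $p, q \in P$, if $p \leqslant^* q$, then there is $r \in P$ with $r \leqslant p$, $r \leqslant q$ and $p \leqslant^* r$; \item for every $\leqslant$-decreasing sequence $(p_i)_{i \in \omega}$ in $P$, there is $p^* \in P$ with $p^* \leqslant^* p_i$ for all $i \in \omega$; \item for every $p \in P$ and every (possibly empty) finite sequence $s$ of elements of $X$, there is $x \in X$ with $s^\frown x \vartriangleleft p$; \item for every nonempty finite sequence $s$ of elements of $X$ and all $p, q \in P$, if $s \vartriangleleft p$ and $p \leqslant q$, then $s \vartriangleleft q$. \end{enumerate} For $p \in P$, \emph{Gowers' game} $G_p$ is the following game: in round $i \in \omega$, player I plays $p_i \in P$ with $p_i \leqslant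 p$, then player II plays $x_i \in X$ with $(x_0, \ldots, x_i) \vartriangleleft p_i$. The \emph{outcome} is the sequence $(x_i)_{i \in \omega} \in X^\omega$. The \emph{asymptotic game} $F_p$ is defined in the same way, except that player I is moreover required to play $p_i$ with $p \leqslant^* p_i$. A player \emph{has a strategy to reach} a set $\mathcal{Y} \subseteq X^\omega$ in one of these games if the player has a strategy, respecting the rules as long as the opponent does, such that the outcome lies in $\mathcal{Y}$ in every run in which the player follows the strategy and the opponent respects the rules. \textbf{Theorem (Abstract Rosendal's theorem).} Let $\mathcal{G} = (P, X, \leqslant, \leqslant^*, \vartriangleleft)$ be a Gowers space, endow $X$ with the discrete topology and $X^\omega$ with the product topology, and let $\mathcal{X} \subseteq X^\omega$ be analytic. Then $\mathcal{X}$ is strategically Ramsey: for every $p \in P$ there exists $q \leqslant p$ such that either player I has a strategy in $F_q$ to reach $\mathcal{X}^c = X^\omega \setminus \mathcal{X}$, or player II has a strategy in $G_q$ to reach $\mathcal{X}$. -/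

import Mathlib

/-- `NeSeq X`: the set of all nonempty finite sequences of elements of `X`. -/
def NeSeq (X : Type*) : Type _ := {s : List X // s ≠ []}

/-- The concatenation of a (possibly empty) finite sequence `s` and of a point `x`. -/
def NeSeq.snoc {X : Type*} (s : List X) (x : X) : NeSeq X := ⟨s ++ [x], by simp⟩

/-- A Gowers space with set of subspaces `P` and set of points `X`. -/
structure GowersSpace (P X : Type*) where
  /-- the quasiorder `≤` on `P` -/
  le : P → P → Prop
  /-- the quasiorder `≤*` on `P` -/
  leStar : P → P → Prop
  /-- the relation `◁` between nonempty finite sequences of points and subspaces -/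
  tri : NeSeq X → P → Prop
  nonempty_subspaces : Nonempty P
  nonempty_points : Nonempty X
  countable_points : Countable X
  le_refl : ∀ p, le p p
  le_trans : ∀ p q r, le p q → le q r → le p r
  leStar_refl : ∀ p, leStar p p
  leStar_trans : ∀ p q r, leStar p q → leStar q r → leStar p r
  leStar_of_le : ∀ p q, le p q → leStar p q
  exists_le_of_leStar : ∀ p q, leStar p q → ∃ r, le r p ∧ le r q ∧ leStar p r
  exists_diagonal : ∀ p : ℕ → P, (∀ i, le (p (i + 1)) (p i)) → ∃ r, ∀ i, leStar r (p i)
  exists_tri : ∀ (p : P) (s : List X), ∃ x, tri (NeSeq.snoc s x) p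
  tri_mono : ∀ (s : NeSeq X) (p q : P), tri s p → le p q → tri s q

/-- The finite sequence `(u 0, …, u (n - 1))`. -/
def initSeg {A : Type*} (u : ℕ → A) (n : ℕ) : List A := (List.range n).map u

/-- An infinite two-player game of perfect information with an outcome. In each round `n`, player I
plays an element of `A`, then player II plays an element of `B`. -/
structure OutcomeGame (A B O : Type*) where
  /-- `ruleI as bs a`: I may play `a` when the previous moves are `as` (by I) and `bs` (by II). -/
  ruleI : List A → List B → A → Prop
  /-- `ruleII as bs a b`: II may answer `b` to the move `a` of I in the current round when the moves
  of the previous rounds are `as` (by I) and `bs` (by II). -/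
  ruleII : List A → List B → A → B → Prop
  /-- The outcome of the run in which I plays `a 0, a 1, …` and II plays `b 0, b 1, …`. -/
  outcome : (ℕ → A) → (ℕ → B) → O

namespace OutcomeGame

variable {A B O : Type*}

/-- In the run `(a, b)`, I respects the rules in round `n`. -/
def LegalI (g : OutcomeGame A B O) (a : ℕ → A) (b : ℕ → B) (n : ℕ) : Prop :=
  g.ruleI (initSeg a n) (initSeg b n) (a n)

/-- In the run `(a, b)`, II respects the rules in round `n`. -/
def LegalII (g : OutcomeGame A B O) (a : ℕ → A) (b : ℕ → B) (n : ℕ) : Prop :=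
  g.ruleII (initSeg a n) (initSeg b n) (a n) (b n)

/-- Player I has a strategy `σ` (giving his next move as a function of the previous moves of II) to
reach `Y`: whenever he follows it, he respects the rules as long as II does, and if II always
respects the rules then the outcome is in `Y`. -/
def IHasStrategy (g : OutcomeGame A B O) (Y : Set O) : Prop :=
  ∃ σ : List B → A, ∀ (a : ℕ → A) (b : ℕ → B), (∀ n, a n = σ (initSeg b n)) →
    (∀ n, (∀ i < n, g.LegalII a b i) → g.LegalI a b n) ∧
    ((∀ n, g.LegalII a b n) → g.outcome a b ∈ Y)

/-- Player II has a strategy `τ` (giving her next move as a function of the moves that I has made so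
far) to reach `Y`: whenever she follows it, she respects the rules as long as I does, and if I always
respects the rules then the outcome is in `Y`. -/
def IIHasStrategy (g : OutcomeGame A B O) (Y : Set O) : Prop :=
  ∃ τ : List A → B, ∀ (a : ℕ → A) (b : ℕ → B), (∀ n, b n = τ (initSeg a (n + 1))) →
    (∀ n, (∀ i ≤ n, g.LegalI a b i) → g.LegalII a b n) ∧
    ((∀ n, g.LegalI a b n) → g.outcome a b ∈ Y)

end OutcomeGame

namespace GowersSpace

variable {P X : Type*}

/-- `p ⪅ q`, that is, `p ≤ q` and `q ≤* p`. -/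
def leApprox (G : GowersSpace P X) (p q : P) : Prop := G.le p q ∧ G.leStar q p

/-- Gowers' game below `p`: I plays subspaces `p₀, p₁, …` with `pᵢ ≤ p`, II plays points
`x₀, x₁, …` with `(x₀, …, xᵢ) ◁ pᵢ`, and the outcome is `(x₀, x₁, …)`. -/
def gowersGame (G : GowersSpace P X) (p : P) : OutcomeGame P X (ℕ → X) where
  ruleI _ _ r := G.le r p
  ruleII _ xs r x := G.tri (NeSeq.snoc xs x) r
  outcome _ x := x

/-- The asymptotic game below `p`: the same as Gowers' game, with the requirement `pᵢ ⪅ p`. -/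
def asymptoticGame (G : GowersSpace P X) (p : P) : OutcomeGame P X (ℕ → X) where
  ruleI _ _ r := G.leApprox r p
  ruleII _ xs r x := G.tri (NeSeq.snoc xs x) r
  outcome _ x := x

/-- `S` is strategically Ramsey. -/
def StrategicallyRamsey (G : GowersSpace P X) (S : Set (ℕ → X)) : Prop :=
  ∀ p : P, ∃ q : P, G.le q p ∧
    ((G.asymptoticGame q).IHasStrategy Sᶜ ∨ (G.gowersGame q).IIHasStrategy S)

end GowersSpace

/-! A nonempty analytic set is the range of a continuous `f` on Baire space. Call a guess `s` alive
at a position `z` if I cannot avoid `cylinderImage f s` from `z` in the asymptotic game. A fusion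
argument (`exists_le_decide`) makes aliveness stable under shrinking the subspace. If the empty
guess is dead at the start, I wins.

Otherwise, below a further subspace, II can drive Gowers' game from any alive pair to one whose
guess has one more term. If not, I could keep the play at positions where every `s ++ [n]` is dead,
run more and more of the corresponding avoiding strategies, and so avoid the union of their cylinder
images, which covers that of `s` (`canAvoid_iUnion`, `exists_le_forall_canAvoid`).

II may have to wait before extending her guess, but only along a well-founded tree, so her guesses
grow to some `α`. An alive guess has in its cylinder image a sequence extending the current
position, and continuity forces `f α` to be the outcome. -/

section InitSeg

/-! ### Initial segments -/

variable {A : Type*}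

theorem initSeg_zero (u : ℕ → A) : initSeg u 0 = [] := rfl

theorem initSeg_succ (u : ℕ → A) (n : ℕ) : initSeg u (n + 1) = initSeg u n ++ [u n] := by
  simp [initSeg, List.range_succ]

@[simp]
theorem length_initSeg (u : ℕ → A) (n : ℕ) : (initSeg u n).length = n := by
  simp [initSeg]

theorem take_initSeg (u : ℕ → A) {k n : ℕ} (h : k ≤ n) :
    (initSeg u n).take k = initSeg u k := by
  simp [initSeg, ← List.map_take, List.take_range, h]

theorem initSeg_eq_iff (u : ℕ → A) (s : List A) :
    initSeg u s.length = s ↔ ∀ i (h : i < s.length), u i = s[i] := by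
  constructor
  · intro h i hi
    have : (initSeg u s.length)[i]'(by simpa using hi) = s[i] := by simp only [h]
    simpa [initSeg] using this
  · intro h
    refine List.ext_getElem (by simp) fun i _ hi => ?_
    simpa [initSeg] using h i hi

theorem initSeg_apply_eq {u v : ℕ → A} {n i : ℕ} (h : initSeg u n = initSeg v n) (hi : i < n) :
    u i = v i := by
  have := (initSeg_eq_iff u (initSeg v n)).1 (by simpa using h) i (by simpa using hi)
  simpa [initSeg] using this

/-- An increasing sequence of finite sequences is approximated by an infinite sequence. -/
theorem exists_initSeg_eq_of_prefix [Nonempty A] (s : ℕ → List A)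
    (hs : ∀ n, s n <+: s (n + 1)) : ∃ u : ℕ → A, ∀ n, initSeg u (s n).length = s n := by
  classical
  have mono : ∀ m n, m ≤ n → s m <+: s n := fun m n h =>
    Nat.le_induction (List.prefix_refl _) (fun k _ ih => ih.trans (hs k)) n h
  refine ⟨fun k => if h : ∃ n, k < (s n).length then (s h.choose)[k]'h.choose_spec
    else Classical.arbitrary A, fun n => (initSeg_eq_iff _ _).2 fun i hi => ?_⟩
  have h : ∃ n, i < (s n).length := ⟨n, hi⟩
  simp only [dif_pos h]
  rcases le_total h.choose n with hle | hle
  · exact (mono _ _ hle).getElem h.choose_spec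
  · exact ((mono _ _ hle).getElem hi).symm

end InitSeg

/-! ### Images of basic open sets of Baire space -/

/-- The image under `f` of the basic open set of sequences extending `s`. -/
def cylinderImage {O : Type*} (f : (ℕ → ℕ) → O) (s : List ℕ) : Set O :=
  f '' {α | initSeg α s.length = s}

theorem exists_mem_cylinderImage_append {O : Type*} {f : (ℕ → ℕ) → O} {s : List ℕ} {y : O}
    (h : y ∈ cylinderImage f s) : ∃ n, y ∈ cylinderImage f (s ++ [n]) := by
  obtain ⟨α, hα, rfl⟩ := h
  refine ⟨α s.length, α, ?_, rfl⟩
  have hα' : initSeg α s.length = s := hα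
  simp [initSeg_succ, hα']

theorem cylinderImage_nil {O : Type*} (f : (ℕ → ℕ) → O) : cylinderImage f [] = Set.range f := by
  simp [cylinderImage, initSeg_zero]

/-! ### Fusion in Gowers spaces -/

namespace GowersSpace

variable {P X : Type*} (G : GowersSpace P X)

/-- A countable family of dense properties that are hereditary for `≤*` can be met at once. -/
theorem exists_le_forall {ι : Type*} [Countable ι] (D : ι → P → Prop)
    (hered : ∀ i p q, G.leStar q p → D i p → D i q) (p : P)
    (dense : ∀ i r, G.le r p → ∃ q, G.le q r ∧ D i q) : ∃ q, G.le q p ∧ ∀ i, D i q := by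
  rcases isEmpty_or_nonempty ι with hι | hι
  · exact ⟨p, G.le_refl p, fun i => hι.elim i⟩
  obtain ⟨e, he⟩ := exists_surjective_nat ι
  choose! g hg hgD using dense
  -- Requirement `e k` is met at stage `k + 1`; stage `0` is `p`, so the diagonal subspace is also
  -- `≤* p`.
  let u : ℕ → P := fun n => Nat.rec p (fun k r => g (e k) r) n
  have hu : ∀ n, G.le (u n) p := by
    intro n
    induction n with
    | zero => exact G.le_refl p
    | succ k ih => exact G.le_trans _ _ _ (hg _ _ ih) ih
  obtain ⟨r, hr⟩ := G.exists_diagonal u fun i => hg _ _ (hu i)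
  obtain ⟨q, hqr, hqp, -⟩ := G.exists_le_of_leStar r p (hr 0)
  refine ⟨q, hqp, fun i => ?_⟩
  obtain ⟨k, rfl⟩ := he i
  exact hered _ _ _ (G.leStar_trans _ _ _ (G.leStar_of_le _ _ hqr) (hr (k + 1)))
    (hgD _ _ (hu k))

/-- A countable family of hereditary properties can be decided by a subspace. -/
theorem exists_le_decide {ι : Type*} [Countable ι] (D : ι → P → Prop)
    (hered : ∀ i p q, G.leStar q p → D i p → D i q) (p : P) :
    ∃ q, G.le q p ∧ ∀ i r, G.le r q → D i r → D i q := by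
  obtain ⟨q, hqp, hq⟩ := G.exists_le_forall (fun i q => D i q ∨ ∀ r, G.le r q → ¬ D i r) (by
      rintro i p q hqp (h | h)
      · exact Or.inl (hered _ _ _ hqp h)
      -- A subspace of `q` has a further subspace below `p`, to which `D i` would descend.
      · refine Or.inr fun r hr hD => ?_
        obtain ⟨t, htr, htp, -⟩ := G.exists_le_of_leStar r p
          (G.leStar_trans _ _ _ (G.leStar_of_le _ _ hr) hqp)
        exact h t htp (hered _ _ _ (G.leStar_of_le _ _ htr) hD)) p (by
      intro i r _
      by_cases h : ∃ t, G.le t r ∧ D i t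
      · obtain ⟨t, ht, hD⟩ := h
        exact ⟨t, ht, Or.inl hD⟩
      · exact ⟨r, G.le_refl r, Or.inr fun t ht hD => h ⟨t, ht, hD⟩⟩)
  refine ⟨q, hqp, fun i r hr hD => ?_⟩
  rcases hq i with h | h
  · exact h
  · exact absurd hD (h r hr)

/-! ### Single moves and avoiding strategies -/

/-- The filter of the sets in which player I, playing in the asymptotic game below `p`, can force
the point following the finite sequence `z` to lie. -/
def moveFilter (p : P) (z : List X) : Filter X where
  sets := {A | ∃ r, G.leStar p r ∧ ∀ x, G.tri (NeSeq.snoc z x) r → x ∈ A}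
  univ_sets := ⟨p, G.leStar_refl p, fun _ _ => trivial⟩
  sets_of_superset := by
    rintro A B ⟨r, hr, h⟩ hAB
    exact ⟨r, hr, fun x hx => hAB (h x hx)⟩
  inter_sets := by
    rintro A B ⟨r, hr, hA⟩ ⟨t, ht, hB⟩
    obtain ⟨u, hup, hur, hpu⟩ := G.exists_le_of_leStar p r hr
    obtain ⟨v, hvu, hvt, huv⟩ := G.exists_le_of_leStar u t
      (G.leStar_trans _ _ _ (G.leStar_of_le _ _ hup) ht)
    exact ⟨v, G.leStar_trans _ _ _ hpu huv, fun x hx =>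
      ⟨hA x (G.tri_mono _ _ _ hx (G.le_trans _ _ _ hvu hur)), hB x (G.tri_mono _ _ _ hx hvt)⟩⟩

theorem moveFilter_anti {p q : P} (h : G.leStar q p) (z : List X) :
    G.moveFilter q z ≤ G.moveFilter p z := by
  rintro A ⟨r, hr, hA⟩
  exact ⟨r, G.leStar_trans _ _ _ h hr, hA⟩

/-- Playing in Gowers' game below `p`, player II can choose the point following `z` in `A`. -/
def Big (p : P) (z : List X) (A : Set X) : Prop :=
  ∀ r, G.le r p → ∃ x ∈ A, G.tri (NeSeq.snoc z x) r

variable {G} in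
theorem Big.anti {p q : P} {z : List X} {A : Set X} (hA : G.Big p z A) (h : G.leStar q p) :
    G.Big q z A := by
  intro r hr
  obtain ⟨t, htr, htp, -⟩ := G.exists_le_of_leStar r p
    (G.leStar_trans _ _ _ (G.leStar_of_le _ _ hr) h)
  obtain ⟨x, hx, hxt⟩ := hA t htp
  exact ⟨x, hx, G.tri_mono _ _ _ hxt htr⟩

/-- A move `r` of I that defeats II's choice in `A` is a legal asymptotic move once the game is
restricted to `r` itself. -/
theorem exists_compl_mem_moveFilter {p : P} {z : List X} {A : Set X} (hA : ¬ G.Big p z A) :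
    ∃ r, G.le r p ∧ Aᶜ ∈ G.moveFilter r z := by
  simp only [Big, not_forall, not_exists, not_and] at hA
  obtain ⟨r, hr, h⟩ := hA
  exact ⟨r, hr, r, G.leStar_refl r, fun x hx hxA => h x hxA hx⟩

/-- Player I has a strategy in the asymptotic game below `p`, started at the finite sequence `z`,
to avoid `Y`. -/
def CanAvoid (p : P) (z : List X) (Y : Set (ℕ → X)) : Prop :=
  ∃ σ : List X → Set X, (∀ w, σ w ∈ G.moveFilter p w) ∧
    ∀ x : ℕ → X, initSeg x z.length = z → (∀ n, z.length ≤ n → x n ∈ σ (initSeg x n)) → x ∉ Y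

variable {G} in
theorem CanAvoid.anti {p q : P} {z : List X} {Y : Set (ℕ → X)} (h : G.CanAvoid p z Y)
    (hqp : G.leStar q p) : G.CanAvoid q z Y := by
  obtain ⟨σ, hσ, h⟩ := h
  exact ⟨σ, fun w => G.moveFilter_anti hqp w (hσ w), h⟩

variable {G} in
theorem CanAvoid.iHasStrategy {p : P} {Y : Set (ℕ → X)} (h : G.CanAvoid p [] Y) :
    (G.asymptoticGame p).IHasStrategy Yᶜ := by
  obtain ⟨σ, hσ, h⟩ := h
  have : ∀ w, ∃ r, G.leApprox r p ∧ ∀ x, G.tri (NeSeq.snoc w x) r → x ∈ σ w := by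
    intro w
    obtain ⟨r, hr, hrσ⟩ := hσ w
    obtain ⟨t, htp, htr, hpt⟩ := G.exists_le_of_leStar p r hr
    exact ⟨t, ⟨htp, hpt⟩, fun x hx => hrσ x (G.tri_mono _ _ _ hx htr)⟩
  choose τ hτp hτ using this
  refine ⟨τ, fun a b hab => ⟨fun n _ => ?_, fun hb => ?_⟩⟩
  · change G.leApprox (a n) p
    rw [hab]
    exact hτp _
  · refine h b rfl fun n _ => hτ _ _ ?_
    have hn : G.tri (NeSeq.snoc (initSeg b n) (b n)) (a n) := hb n
    rwa [hab] at hn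

/-! ### Reaching trees and how I stays out of them -/

/-- Well-founded strategies of player II in Gowers' game below `p`, started at a finite sequence,
to reach the set `R` of finite sequences. -/
inductive ReachTree (p : P) (R : Set (List X)) : List X → Type _
  | leaf (z : List X) (h : z ∈ R) : ReachTree p R z
  | node (z : List X) (A : Set X) (hA : G.Big p z A)
      (next : ∀ x ∈ A, ReachTree p R (z ++ [x])) : ReachTree p R z

theorem nonempty_reachTree_of_big {p : P} {R : Set (List X)} {z : List X}
    (h : G.Big p z {x | Nonempty (G.ReachTree p R (z ++ [x]))}) :
    Nonempty (G.ReachTree p R z) :=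
  ⟨.node z _ h fun _ hx => Classical.choice hx⟩

theorem nonempty_reachTree_anti {p q : P} (hqp : G.leStar q p) {R : Set (List X)} {z : List X}
    (h : Nonempty (G.ReachTree p R z)) : Nonempty (G.ReachTree q R z) := by
  obtain ⟨t⟩ := h
  induction t with
  | leaf z h => exact ⟨.leaf z h⟩
  | node z A hA next ih => exact ⟨.node z A (hA.anti hqp) fun x hx => Classical.choice (ih x hx)⟩

/-- If player I can keep the finite sequences out of `R` after the next move, and can avoid `Y n`
from every finite sequence outside `R`, then he can avoid `⋃ n, Y n`. -/
theorem canAvoid_iUnion {q : P} {z : List X} {Y : ℕ → Set (ℕ → X)} (R : Set (List X))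
    (hR : ∀ w, w = z ∨ w ∉ R → {x | w ++ [x] ∉ R} ∈ G.moveFilter q w)
    (hY : ∀ w ∉ R, ∀ n, G.CanAvoid q w (Y n)) : G.CanAvoid q z (⋃ n, Y n) := by
  classical
  have : ∀ w n, ∃ σ : List X → Set X, (∀ v, σ v ∈ G.moveFilter q v) ∧ (w ∉ R → ∀ x : ℕ → X,
      initSeg x w.length = w → (∀ m, w.length ≤ m → x m ∈ σ (initSeg x m)) → x ∉ Y n) := by
    intro w n
    by_cases hw : w ∈ R
    · exact ⟨fun _ => Set.univ, fun _ => Filter.univ_mem, fun h => absurd hw h⟩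
    · obtain ⟨σ, h1, h2⟩ := hY w hw n
      exact ⟨σ, h1, fun _ => h2⟩
  choose σ hσ hσY using this
  -- The `n`-th avoiding strategy starts at length `z.length + 1 + n`, so only finitely many filter
  -- sets are intersected at each move. Values of `n` not yet due truncate nothing and only add
  -- harmless constraints.
  refine ⟨fun w => {x | w = z ∨ w ∉ R → w ++ [x] ∉ R} ∩
    ⋂ n ∈ Finset.range w.length, σ (w.take (z.length + 1 + n)) n w, fun w => ?_, ?_⟩
  · refine Filter.inter_mem ?_ ((Filter.biInter_finset_mem _).2 fun n _ => hσ _ _ _)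
    by_cases hw : w = z ∨ w ∉ R
    · filter_upwards [hR w hw] with x hx _ using hx
    · filter_upwards with x h using absurd h hw
  · intro x hxz hx
    have avoid : ∀ k, initSeg x (z.length + 1 + k) ∉ R := by
      intro k
      induction k with
      | zero =>
        have := (hx z.length le_rfl).1 (Or.inl hxz)
        rwa [← initSeg_succ] at this
      | succ k ih =>
        have := (hx (z.length + 1 + k) (by omega)).1 (Or.inr ih)
        rwa [← initSeg_succ] at this
    simp only [Set.mem_iUnion, not_exists]
    intro n
    refine hσY _ n (avoid n) x (by simp) fun m hm => ?_
    rw [length_initSeg] at hm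
    have := Set.mem_iInter₂.1 (hx m (by omega)).2 n (by simp; omega)
    rwa [take_initSeg _ hm] at this

/-- Below every subspace there is one below which, for each `R` of a countable family, player I can
keep out of `R` from all finite sequences from which player II cannot reach `R`. -/
theorem exists_le_forall_canAvoid {ι : Type*} [Countable ι] (R : ι → Set (List X)) (p : P) :
    ∃ q, G.le q p ∧ ∀ i z, ¬ G.Big q z {x | Nonempty (G.ReachTree q (R i) (z ++ [x]))} →
      ∃ r, G.le r q ∧ ∀ Y : ℕ → Set (ℕ → X),
        (∀ w ∉ R i, ∀ n, G.CanAvoid q w (Y n)) → G.CanAvoid r z (⋃ n, Y n) := by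
  have := G.countable_points
  obtain ⟨q, hqp, hq⟩ := G.exists_le_decide
    (fun (i : ι × List X) r => Nonempty (G.ReachTree r (R i.1) i.2))
    (fun i p q hqp => G.nonempty_reachTree_anti hqp) p
  refine ⟨q, hqp, fun i z hz => ?_⟩
  obtain ⟨r, hrq, hr⟩ := G.exists_compl_mem_moveFilter hz
  let T : Set (List X) := {w | Nonempty (G.ReachTree q (R i) w)}
  obtain ⟨t, htr, ht⟩ := G.exists_le_forall
    (fun w u => w ∉ T → {x | w ++ [x] ∉ T} ∈ G.moveFilter u w)
    (fun w u v hvu h hw => G.moveFilter_anti hvu w (h hw)) r (by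
      intro w u hu
      by_cases hw : w ∈ T
      · exact ⟨u, G.le_refl u, fun h => absurd hw h⟩
      have huq := G.le_trans _ _ _ hu hrq
      -- If II could choose such a point below `u`, the trees would combine into one for `u`, which
      -- `hq` lifts to `q`, giving `w ∈ T`.
      obtain ⟨v, hvu, hv⟩ := G.exists_compl_mem_moveFilter
        (fun h => hw (hq (i, w) u huq (G.nonempty_reachTree_of_big h)))
      refine ⟨v, hvu, fun _ => Filter.mem_of_superset hv fun x hx hxT => hx ?_⟩
      exact G.nonempty_reachTree_anti (G.leStar_of_le _ _ huq) hxT)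
  have htq := G.le_trans _ _ _ htr hrq
  refine ⟨t, htq, fun Y hY => G.canAvoid_iUnion T ?_ fun w hw n => ?_⟩
  -- The starting position may itself lie in `T`; the choice of `r` handles the first move from it.
  · rintro w (rfl | hw)
    · exact G.moveFilter_anti (G.leStar_of_le _ _ htr) w hr
    · exact ht w hw
  · exact (hY w (fun h => hw ⟨.leaf w h⟩) n).anti (G.leStar_of_le _ _ htq)

/-! ### Player II's strategy by successive guesses -/

/-- In Gowers' game below `q`, player II can pass from every alive pair (finite sequence of points,
guess) to one with a longer guess, in at least one move. -/
def Extends (q : P) (Alive : List ℕ → Set (List X)) : Prop :=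
  ∀ s, ∀ z ∈ Alive s,
    G.Big q z {x | Nonempty (G.ReachTree q {w | ∃ n, w ∈ Alive (s ++ [n])} (z ++ [x]))}

/-- The states of player II's strategy: the points played, the current guess, and a strategy to
reach a position in which the guess can be extended. -/
structure GuessState (q : P) (Alive : List ℕ → Set (List X)) where
  word : List X
  guess : List ℕ
  tree : G.ReachTree q {w | ∃ n, w ∈ Alive (guess ++ [n])} word

variable {G}

/-- The state `t` results from the state `s` by one move along its reaching strategy. -/
inductive GuessState.Child {q : P} {Alive : List ℕ → Set (List X)} :
    G.GuessState q Alive → G.GuessState q Alive → Prop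
  | mk (z : List X) (s : List ℕ) (A : Set X) (hA : G.Big q z A)
      (next : ∀ x ∈ A, G.ReachTree q {w | ∃ n, w ∈ Alive (s ++ [n])} (z ++ [x]))
      (x : X) (hx : x ∈ A) : Child ⟨z ++ [x], s, next x hx⟩ ⟨z, s, .node z A hA next⟩

theorem GuessState.wellFounded_child {q : P} {Alive : List ℕ → Set (List X)} :
    WellFounded (GuessState.Child (G := G) (q := q) (Alive := Alive)) := by
  refine ⟨fun ⟨z, s, t⟩ => ?_⟩
  induction t with
  | leaf z h => exact ⟨_, fun _ hy => by cases hy⟩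
  | node z A hA next ih =>
    refine ⟨_, fun _ hy => ?_⟩
    cases hy
    exact ih _ _

/-- At a node, II moves to a subtree. At a leaf, the guess is extended and `Extends` supplies both
the move and a new tree, so no round is spent without playing a point. -/
theorem GuessState.exists_move {q : P} {Alive : List ℕ → Set (List X)} (hq : G.Extends q Alive)
    (s : G.GuessState q Alive) (r : P) : ∃ (x : X) (t : G.GuessState q Alive),
      t.word = s.word ++ [x] ∧ (G.le r q → G.tri (NeSeq.snoc s.word x) r) ∧
      (t.Child s ∨ ∃ n, t.guess = s.guess ++ [n] ∧ s.word ∈ Alive t.guess) := by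
  have key : ∀ (z : List X) (A : Set X), G.Big q z A →
      ∃ x ∈ A, G.le r q → G.tri (NeSeq.snoc z x) r := by
    intro z A hA
    -- An illegal `r` is answered as if it were `q`, to make the strategy total.
    by_cases hr : G.le r q
    · obtain ⟨x, hx, h⟩ := hA r hr
      exact ⟨x, hx, fun _ => h⟩
    · obtain ⟨x, hx, -⟩ := hA q (G.le_refl q)
      exact ⟨x, hx, fun h => absurd h hr⟩
  obtain ⟨z, s, t⟩ := s
  cases t with
  | leaf _ h =>
    obtain ⟨n, hn⟩ := h
    obtain ⟨x, ⟨t⟩, hx⟩ := key z _ (hq _ z hn)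
    exact ⟨x, ⟨z ++ [x], s ++ [n], t⟩, rfl, hx, Or.inr ⟨n, rfl, hn⟩⟩
  | node _ A hA next =>
    obtain ⟨x, hxA, hx⟩ := key z A hA
    exact ⟨x, ⟨z ++ [x], s, next x hxA⟩, rfl, hx, Or.inl (.mk z s A hA next x hxA)⟩

theorem GuessState.Child.guess_eq {q : P} {Alive : List ℕ → Set (List X)}
    {s t : G.GuessState q Alive} (h : t.Child s) : t.guess = s.guess := by
  cases h; rfl

/-- Along an infinite sequence of moves, the guesses build an infinite sequence all of whose finite
parts are alive along the play. -/
theorem GuessState.exists_limit {q : P} {Alive : List ℕ → Set (List X)}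
    (st : ℕ → G.GuessState q Alive)
    (h : ∀ n, (st (n + 1)).Child (st n) ∨
      ∃ k, (st (n + 1)).guess = (st n).guess ++ [k] ∧ (st n).word ∈ Alive (st (n + 1)).guess) :
    ∃ α : ℕ → ℕ, ∀ m, ∃ n ≥ m, ∃ k ≥ m, (st n).word ∈ Alive (initSeg α k) := by
  have hpre : ∀ n, (st n).guess <+: (st (n + 1)).guess := by
    intro n
    rcases h n with hn | ⟨k, hk, -⟩
    · rw [hn.guess_eq]
    · rw [hk]; exact List.prefix_append _ _
  have hinf : ∀ m, ∃ n ≥ m, ∃ k, (st (n + 1)).guess = (st n).guess ++ [k] ∧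
      (st n).word ∈ Alive (st (n + 1)).guess := by
    intro m
    by_contra hm
    push Not at hm
    -- Without further extensions, all moves after `m` would descend in a single well-founded tree.
    obtain ⟨-, ⟨i, rfl⟩, hi⟩ := GuessState.wellFounded_child.has_min
      (Set.range fun i => st (m + i)) ⟨_, 0, rfl⟩
    rcases h (m + i) with hc | ⟨k, hk, hk'⟩
    · exact hi _ ⟨i + 1, rfl⟩ hc
    · exact hm (m + i) (by omega) k hk hk'
  have hmono : Monotone fun n => (st n).guess.length :=
    monotone_nat_of_le_succ fun n => (hpre n).length_le
  have hlen : ∀ m, ∃ N, m ≤ (st N).guess.length := by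
    intro m
    induction m with
    | zero => exact ⟨0, Nat.zero_le _⟩
    | succ m ih =>
      obtain ⟨N, hN⟩ := ih
      obtain ⟨n, hn, k, hk, -⟩ := hinf N
      have h1 := hmono hn
      refine ⟨n + 1, ?_⟩
      simp only [hk, List.length_append, List.length_singleton]
      simp only at h1
      omega
  obtain ⟨α, hα⟩ := exists_initSeg_eq_of_prefix (fun n => (st n).guess) hpre
  refine ⟨α, fun m => ?_⟩
  obtain ⟨N, hN⟩ := hlen m
  obtain ⟨n, hn, k, -, hk⟩ := hinf (max m N)
  refine ⟨n, _root_.le_trans (le_max_left _ _) hn, (st (n + 1)).guess.length, ?_, ?_⟩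
  · exact hN.trans (hmono (show N ≤ n + 1 by have := le_max_right m N; omega))
  · rwa [hα (n + 1)]

theorem iiHasStrategy_of_extends {q : P} {Alive : List ℕ → Set (List X)}
    (hq : G.Extends q Alive) (h0 : [] ∈ Alive []) {S : Set (ℕ → X)}
    (hS : ∀ (x : ℕ → X) (α : ℕ → ℕ),
      (∀ m, ∃ n ≥ m, ∃ k ≥ m, initSeg x n ∈ Alive (initSeg α k)) → x ∈ S) :
    (G.gowersGame q).IIHasStrategy S := by
  obtain ⟨t0⟩ := G.nonempty_reachTree_of_big (hq [] [] h0)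
  choose mv nx hword htri hnext using GuessState.exists_move hq
  let st : List P → G.GuessState q Alive := fun l => l.foldl nx ⟨[], [], t0⟩
  have hst : ∀ (a : ℕ → P) n, st (initSeg a (n + 1)) = nx (st (initSeg a n)) (a n) := by
    intro a n
    simp [st, initSeg_succ]
  -- The state depends on I's earlier moves only; the default `q` is never used, as I has already
  -- moved.
  refine ⟨fun l => mv (st l.dropLast) (l.getLastD q), fun a b hab => ?_⟩
  have hb : ∀ n, b n = mv (st (initSeg a n)) (a n) := by
    intro n
    rw [hab, initSeg_succ]
    simp
  have hw : ∀ n, (st (initSeg a n)).word = initSeg b n := by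
    intro n
    induction n with
    | zero => rfl
    | succ n ih => rw [hst, hword, ih, ← hb, initSeg_succ]
  refine ⟨fun n hn => ?_, fun _ => ?_⟩
  · change G.tri (NeSeq.snoc (initSeg b n) (b n)) (a n)
    rw [← hw, hb]
    exact htri _ _ (hn n le_rfl)
  · obtain ⟨α, hα⟩ := GuessState.exists_limit (fun n => st (initSeg a n)) fun n => by
      simp only [hst]
      exact hnext _ _
    refine hS b α fun m => ?_
    simpa only [hw] using hα m

/-- If no element of `Y` extended `z`, the strategy imposing no constraint would avoid `Y`. -/
theorem exists_mem_of_not_canAvoid {p : P} {z : List X} {Y : Set (ℕ → X)}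
    (h : ¬ G.CanAvoid p z Y) : ∃ y ∈ Y, initSeg y z.length = z := by
  by_contra hc
  push Not at hc
  exact h ⟨fun _ => Set.univ, fun _ => Filter.univ_mem, fun x hx _ hxY => hc x hxY hx⟩

end GowersSpace

/-! ### Continuity and conclusion -/

/-- The preimages `β m` converge to `α` while their images converge to `x`, and limits are unique.
-/
theorem eq_of_forall_exists_cylinderImage {X : Type*} [TopologicalSpace X] [DiscreteTopology X]
    {f : (ℕ → ℕ) → ℕ → X} (hf : Continuous f) {x : ℕ → X} {α : ℕ → ℕ}
    (h : ∀ m, ∃ n ≥ m, ∃ k ≥ m, ∃ y ∈ cylinderImage f (initSeg α k), initSeg y n = initSeg x n) :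
    f α = x := by
  choose n hn k hk y hy hyx using h
  choose β hβ hβy using hy
  have hβ' : ∀ m, initSeg (β m) (k m) = initSeg α (k m) := fun m => by
    have := hβ m
    rwa [Set.mem_ofPred_eq, length_initSeg] at this
  have hlim : Filter.Tendsto β Filter.atTop (nhds α) := by
    refine tendsto_pi_nhds.2 fun i => tendsto_const_nhds.congr' ?_
    filter_upwards [Filter.eventually_gt_atTop i] with m hm
    exact (initSeg_apply_eq (hβ' m) (hm.trans_le (hk m))).symm
  funext i
  refine tendsto_nhds_unique ((tendsto_pi_nhds.1 ((hf.tendsto α).comp hlim)) i) ?_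
  refine tendsto_const_nhds.congr' ?_
  filter_upwards [Filter.eventually_gt_atTop i] with m hm
  rw [Function.comp_apply, hβy]
  exact (initSeg_apply_eq (hyx m) (hm.trans_le (hn m))).symm

theorem mainTheorem3 {P X : Type*} [TopologicalSpace X] [DiscreteTopology X]
    (G : GowersSpace P X) (S : Set (ℕ → X)) (hS : MeasureTheory.AnalyticSet S) :
    G.StrategicallyRamsey S := by
  intro p
  rw [MeasureTheory.AnalyticSet] at hS
  rcases hS with rfl | ⟨f, hf, rfl⟩
  · refine ⟨p, G.le_refl p, Or.inl (GowersSpace.CanAvoid.iHasStrategy ?_)⟩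
    exact ⟨fun _ => Set.univ, fun _ => Filter.univ_mem, fun _ _ _ => id⟩
  have := G.countable_points
  obtain ⟨q, hqp, hq⟩ := G.exists_le_decide
    (fun (i : List ℕ × List X) r => G.CanAvoid r i.2 (cylinderImage f i.1))
    (fun i p q hqp h => h.anti hqp) p
  let Alive : List ℕ → Set (List X) := fun s => {z | ¬ G.CanAvoid q z (cylinderImage f s)}
  by_cases h0 : [] ∈ Alive []
  swap
  · refine ⟨q, hqp, Or.inl (GowersSpace.CanAvoid.iHasStrategy ?_)⟩
    rw [← cylinderImage_nil]
    exact not_not.1 h0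
  obtain ⟨r, hrq, hr⟩ := G.exists_le_forall_canAvoid
    (fun s : List ℕ => {w | ∃ n, w ∈ Alive (s ++ [n])}) q
  refine ⟨r, G.le_trans _ _ _ hrq hqp, Or.inr ?_⟩
  refine GowersSpace.iiHasStrategy_of_extends (Alive := Alive) (fun s z hz => ?_) h0
    fun x α h => ⟨α, eq_of_forall_exists_cylinderImage hf fun m => ?_⟩
  · by_contra hc
    obtain ⟨t, htr, ht⟩ := hr s z hc
    -- Avoidance below the smaller `t` lifts back to `q`, contradicting that `s` is alive at `z`.
    refine hz (hq (s, z) t (G.le_trans _ _ _ htr hrq) ?_)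
    obtain ⟨σ, hσ, hσY⟩ := ht (fun n => cylinderImage f (s ++ [n])) fun w hw n =>
      GowersSpace.CanAvoid.anti (not_not.1 fun h => hw ⟨n, h⟩) (G.leStar_of_le _ _ hrq)
    exact ⟨σ, hσ, fun x hx hxσ hxs => hσY x hx hxσ
      (Set.mem_iUnion.2 (exists_mem_cylinderImage_append hxs))⟩
  · obtain ⟨n, hn, k, hk, hnk⟩ := h m
    obtain ⟨y, hy, hyx⟩ := GowersSpace.exists_mem_of_not_canAvoid hnk
    exact ⟨n, hn, k, hk, y, hy, by simpa using hyx⟩
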